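/- Let $k$ be a field and $d\ge 0$ an integer. For a $k$-algebra $R$ let $Q_d(R)$ be the set of monic polynomials of degree $d$ in $R[t]$, $A_d(R)$ the set of polynomials of degree less than $d$ in $R[t]$, $\mathcal L\mathbb A^1(R)=R[[t]]$, $\mathcal L\mathbb G_m(R)=R[[t]]^\times$ and $\mathcal L_n\mathbb A^1(R)=R[t]/(t^{n+1})$; these functors are represented by affine $k$-schemes. Consider the morphisms $$\alpha_d:Q_d\times A_d\times\mathcal L\mathbb A^1\to Q_d\times\mathcal L\mathbb A^1,\qquad \alpha_d(q,a,v)=(q,qv+a),$$ $$\mathrm d\beta_d:Q_d\times\mathcal L\mathbb G_m\times A_d\times\mathcal L\mathbb A^1\to Q_d\times\mathcal L\mathbb G_m\times\mathcal L\mathbb A^1,\qquad \mathrm d\beta_d(q,u,a,v)=(q,u,ua+qv);$$ the second is the differential $\mathrm TX\to \mathrm TY\times_YX$ of the morphism $\beta_d:X=Q_d\times\mathcal L\mathbb G_m\to Y$, $\beta_d(q,u)=qu$, where $Y\subset\mathcal L\mathbb A^1$ is the open subscheme of non-degenerate arcs (the union over $e\ge 0$ of the open subschemes on which the coefficients of $1,t,\dots,t^e$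 have no common zero). For a point $x$ of a scheme $X$ let $\hat X_x=\mathrm{Spf}\,\varprojlim_n\mathcal O_{X,x}/\mathfrak m_x^n$ be the formal completion, that is, the functor $R\mapsto\varinjlim_n\mathrm{Hom}(\mathcal O_{X,x}/\mathfrak m_x^n,R)$ on commutative rings. Then: 1. $\alpha_d$ and $\mathrm d\beta_d$ are surjective; moreover they are surjective on $K$-points for every field $K$ containing $k$. 2. For $f:X\to Y$ equal to $\alpha_d$ or $\mathrm d\beta_d$ and every point $x$ of the source, the induced morphism $\hat X_x\to\hat Y_{f(x)}$ is formally smooth: for every commutative ring $R$ and every nilpotent ideal $I\subset R$, the map $\hat X_x(R)\to\hat X_x(R/I)\times_{\hat Y_{f(x)}(R/I)}\hat Y_{f(x)}(R)$ is surjective. 3. If moreover $x$ lies over the point $q=t^d$ of $Q_d$, then $\hat X_x\to\hat Y_{f(x)}$ is an isomorphism. 4. For every $n\ge d$, the morphism $\alpha_{d,n}:Q_d\times A_d\times\mathcal L_n\mathbb A^1\to Q_d\times\mathcal L_n\mathbb A^1$, $(q,a,v)\mapsto(q,qv+a)$, is a linear morphism of vector bundles of finite rank over $Q_d$, and it is surjective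 on the fibre over every point $q\in Q_d(K)$, for every field $K$ containing $k$. -/

import Mathlib

/-!
All the schemes below are affine over a field `k` and are given by their coordinate `k`-algebras;
a morphism of schemes is given by its comorphism. Points of a scheme are prime ideals of its
coordinate algebra, and `R`-points are `k`-algebra homomorphisms to `R`.
-/

universe u v

noncomputable section

namespace WeierstrassDivision

/-! ### Polynomials and series with given coefficients -/

section Coefficients

variable {R : Type*} [CommRing R] {d : ℕ}

/-- The polynomial `c₀ + c₁ t + ⋯ + c_{d-1} t^{d-1}` of degree less than `d`. -/
def lowPoly (c : Fin d → R) : Polynomial R :=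
  ∑ i, Polynomial.C (c i) * Polynomial.X ^ (i : ℕ)

/-- The monic polynomial `c₀ + c₁ t + ⋯ + c_{d-1} t^{d-1} + t^d`. -/
def monicPoly (c : Fin d → R) : Polynomial R :=
  lowPoly c + Polynomial.X ^ d

/-- The series `(q_c) v + a` for `q_c = monicPoly c`. -/
def alphaSeries (c a : Fin d → R) (v : ℕ → R) : PowerSeries R :=
  (monicPoly c : PowerSeries R) * PowerSeries.mk v + (lowPoly a : PowerSeries R)

/-- The series `(q_c) u` for `q_c = monicPoly c`. -/
def betaSeries (c : Fin d → R) (u : ℕ → R) : PowerSeries R :=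
  (monicPoly c : PowerSeries R) * PowerSeries.mk u

/-- The series `u a + (q_c) v` for `q_c = monicPoly c`. -/
def dBetaSeries (c : Fin d → R) (u : ℕ → R) (a : Fin d → R) (v : ℕ → R) : PowerSeries R :=
  PowerSeries.mk u * (lowPoly a : PowerSeries R) +
    (monicPoly c : PowerSeries R) * PowerSeries.mk v

/-- A polynomial representing `(q_c) v + a` in `R[t] / (t^{n+1})`, where `v` is the jet
`v₀ + v₁ t + ⋯ + v_n t^n`. -/
def alphaJet {n : ℕ} (c a : Fin d → R) (v : Fin (n + 1) → R) : Polynomial R :=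
  monicPoly c * lowPoly v + lowPoly a

end Coefficients

/-! ### The coordinate algebras and the morphisms -/

section Schemes

variable (k : Type u) [Field k] (d : ℕ)

/-- The coordinate algebra `k[q₀, …, q_{d-1}]` of the space `Q_d` of monic polynomials of
degree `d`. -/
abbrev CoordQ : Type u := MvPolynomial (Fin d) k

/-- The coordinate algebra of `Q_d × A_d × L𝔸¹`: the polynomial algebra over `CoordQ k d` in
`a₀, …, a_{d-1}` (indices `Sum.inl i`) and `v₀, v₁, …` (indices `Sum.inr j`). -/
abbrev CoordQAL : Type u := MvPolynomial (Fin d ⊕ ℕ) (CoordQ k d)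

/-- The coordinate algebra of `Q_d × L𝔸¹`. -/
abbrev CoordQL : Type u := MvPolynomial ℕ (CoordQ k d)

/-- The division morphism `α_d : Q_d × A_d × L𝔸¹ → Q_d × L𝔸¹`, `(q, a, v) ↦ (q, q v + a)`. -/
def alpha : CoordQL k d →ₐ[CoordQ k d] CoordQAL k d :=
  MvPolynomial.aeval fun n => PowerSeries.coeff n
    (alphaSeries (fun i => MvPolynomial.C (MvPolynomial.X i))
      (fun i => MvPolynomial.X (Sum.inl i)) (fun j => MvPolynomial.X (Sum.inr j)))

/-- The morphism `α_{d,n} : Q_d × A_d × L_n𝔸¹ → Q_d × L_n𝔸¹` of spaces of `n`-jets,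
`(q, a, v) ↦ (q, q v + a)`. -/
def alphaN (n : ℕ) :
    MvPolynomial (Fin (n + 1)) (CoordQ k d) →ₐ[CoordQ k d]
      MvPolynomial (Fin d ⊕ Fin (n + 1)) (CoordQ k d) :=
  MvPolynomial.aeval fun i => Polynomial.coeff (R := MvPolynomial (Fin d ⊕ Fin (n + 1)) (CoordQ k d))
    (alphaJet (fun i => MvPolynomial.C (MvPolynomial.X i))
      (fun i => MvPolynomial.X (Sum.inl i)) (fun j => MvPolynomial.X (Sum.inr j))) (i : ℕ)

/-- The coordinate algebra `k[q₀, …, q_{d-1}, u₀, u₁, …][u₀⁻¹]` of `Q_d × L𝔾_m`. -/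
abbrev CoordQG : Type u :=
  Localization.Away (MvPolynomial.X (Sum.inr 0) : MvPolynomial (Fin d ⊕ ℕ) k)

/-- The coordinate functions `q_i` on `Q_d × L𝔾_m`. -/
def coordq (i : Fin d) : CoordQG k d :=
  algebraMap (MvPolynomial (Fin d ⊕ ℕ) k) (CoordQG k d) (MvPolynomial.X (Sum.inl i))

/-- The coordinate functions `u_j` on `Q_d × L𝔾_m`. -/
def coordu (j : ℕ) : CoordQG k d :=
  algebraMap (MvPolynomial (Fin d ⊕ ℕ) k) (CoordQG k d) (MvPolynomial.X (Sum.inr j))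

/-- The morphism `β_d : Q_d × L𝔾_m → L𝔸¹`, `(q, u) ↦ q u`. It factors through the open subscheme
of non-degenerate arcs. -/
def beta : MvPolynomial ℕ k →ₐ[k] CoordQG k d :=
  MvPolynomial.aeval fun n => PowerSeries.coeff n (betaSeries (coordq k d) (coordu k d))

/-- The coordinate algebra of the tangent bundle `TX = Q_d × L𝔾_m × A_d × L𝔸¹` of
`X = Q_d × L𝔾_m`. -/
abbrev CoordTX : Type u := MvPolynomial (Fin d ⊕ ℕ) (CoordQG k d)

/-- The coordinate algebra of `TY ×_Y X = Q_d × L𝔾_m × L𝔸¹`, for `X = Q_d × L𝔾_m` and `Y` the open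
subscheme of non-degenerate arcs of `L𝔸¹`. -/
abbrev CoordTYX : Type u := MvPolynomial ℕ (CoordQG k d)

/-- The differential `dβ_d : TX → TY ×_Y X`, `(q, u, a, v) ↦ (q, u, u a + q v)`. That it is the
differential of `β_d` is the content of `exists_unique_tangent` and `snd_beta` below. -/
def dBeta : CoordTYX k d →ₐ[CoordQG k d] CoordTX k d :=
  MvPolynomial.aeval fun n => PowerSeries.coeff n
    (dBetaSeries (fun i => MvPolynomial.C (coordq k d i)) (fun j => MvPolynomial.C (coordu k d j))
      (fun i => MvPolynomial.X (Sum.inl i)) (fun j => MvPolynomial.X (Sum.inr j)))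

end Schemes

/-! ### Formal completions at points -/

section Completion

/-- The `R`-points of the formal completion `Spf (lim O / 𝔪ⁿ)` of a local ring `O`: the
elements of `colim Hom (O / 𝔪ⁿ, R)`, that is, the ring homomorphisms `O → R` that kill some power
of the maximal ideal. -/
def FormalPt (O : Type u) [CommRing O] [IsLocalRing O] (R : Type u) [CommRing R] : Type u :=
  {f : O →+* R // ∃ n : ℕ, IsLocalRing.maximalIdeal O ^ n ≤ RingHom.ker f}

/-- Base change of points of a formal completion along `R → R'`. -/
def FormalPt.reduce {O : Type u} [CommRing O] [IsLocalRing O] {R R' : Type u} [CommRing R]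
    [CommRing R'] (g : R →+* R') (f : FormalPt O R) : FormalPt O R' :=
  ⟨g.comp f.1, f.2.imp fun _ h x hx => by
    have h0 : f.1 x = 0 := h hx
    simp [RingHom.mem_ker, h0]⟩

/-- The map on `R`-points of formal completions induced by a local homomorphism. -/
def FormalPt.comp {O O' : Type u} [CommRing O] [IsLocalRing O] [CommRing O'] [IsLocalRing O']
    {R : Type u} [CommRing R] (f : FormalPt O R) (g : O' →+* O) (hg : IsLocalHom g) :
    FormalPt O' R :=
  ⟨f.1.comp g, f.2.imp fun n h x hx => by
    have h1 : Ideal.map g (IsLocalRing.maximalIdeal O') ≤ IsLocalRing.maximalIdeal O :=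
      ((IsLocalRing.local_hom_TFAE g).out 0 2).mp hg
    have h2 : g x ∈ IsLocalRing.maximalIdeal O ^ n := by
      have := Ideal.mem_map_of_mem g hx
      rw [Ideal.map_pow] at this
      exact Ideal.pow_right_mono h1 n this
    exact h h2⟩

variable {A B : Type u} [CommRing A] [CommRing B]

/-- For a morphism `f : Spec A → Spec B` with comorphism `φ` and a point `x` of `Spec A`, the map
`(Spec A)^_x (R) → (Spec B)^_{f x} (R)` on `R`-points of formal completions. -/
def completionMap (φ : B →+* A) (x : PrimeSpectrum A) (R : Type u) [CommRing R] :
    FormalPt (Localization.AtPrime x.asIdeal) R →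
      FormalPt (Localization.AtPrime (x.asIdeal.comap φ)) R :=
  fun f => f.comp (Localization.localRingHom (x.asIdeal.comap φ) x.asIdeal φ rfl)
    (Localization.isLocalHom_localRingHom _ _ _ rfl)

/-- The morphism of formal completions at `x` is formally smooth: the infinitesimal lifting
property along `R → R / I` with `I` nilpotent. -/
def FormallySmoothOnCompletion (φ : B →+* A) (x : PrimeSpectrum A) : Prop :=
  ∀ (R : Type u) [CommRing R] (I : Ideal R), IsNilpotent I →
    ∀ (g : FormalPt (Localization.AtPrime (x.asIdeal.comap φ)) R)
      (f₀ : FormalPt (Localization.AtPrime x.asIdeal) (R ⧸ I)),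
      completionMap φ x (R ⧸ I) f₀ = g.reduce (Ideal.Quotient.mk I) →
      ∃ f : FormalPt (Localization.AtPrime x.asIdeal) R,
        completionMap φ x R f = g ∧ f.reduce (Ideal.Quotient.mk I) = f₀

/-- The morphism of formal completions at `x` is an isomorphism (of functors of points). -/
def IsIsoOnCompletion (φ : B →+* A) (x : PrimeSpectrum A) : Prop :=
  ∀ (R : Type u) [CommRing R], Function.Bijective (completionMap φ x R)

/-- The value at the point `x` of the family of monic polynomials `monicPoly c` is `t^d`. -/
def IsOverOrigin {d : ℕ} (c : Fin d → A) (x : PrimeSpectrum A) : Prop :=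
  (monicPoly c).map (algebraMap A x.asIdeal.ResidueField) = Polynomial.X ^ d

end Completion

/-! ### Morphisms of trivial vector bundles -/

section Bundles

variable {S : Type u} [CommRing S] {ι κ : Type}

/-- For a morphism `Spec S[κ] → Spec S[ι]` over `Spec S` between trivial vector bundles and an
`R`-point `s` of the base, the map `R^κ → R^ι` induced on the `R`-points of the fibres over `s`. -/
def fiberMap (φ : MvPolynomial ι S →ₐ[S] MvPolynomial κ S) {R : Type v} [CommRing R]
    (s : S →+* R) (w : κ → R) : ι → R :=
  fun i => MvPolynomial.eval₂ s w (φ (MvPolynomial.X i))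

/-- The morphism of trivial vector bundles is linear: it is linear on the fibres over every
`R`-point of the base, for every `R`. -/
def IsBundleLinear (φ : MvPolynomial ι S →ₐ[S] MvPolynomial κ S) : Prop :=
  ∀ (R : Type u) [CommRing R] (s : S →+* R), IsLinearMap R (fiberMap φ s)

end Bundles

/-! ### The morphisms on `R`-points, and the differential of `β_d` -/

section Points

variable {R S : Type*} [CommRing R] [CommRing S] {d : ℕ}

lemma map_lowPoly (f : S →+* R) (c : Fin d → S) :
    (lowPoly c).map f = lowPoly (fun i => f (c i)) := by
  simp [lowPoly, Polynomial.map_sum]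

lemma map_monicPoly (f : S →+* R) (c : Fin d → S) :
    (monicPoly c).map f = monicPoly (fun i => f (c i)) := by
  simp [monicPoly, map_lowPoly]

lemma map_mk (f : S →+* R) (v : ℕ → S) :
    PowerSeries.map f (PowerSeries.mk v) = PowerSeries.mk (fun i => f (v i)) := by
  ext; simp

lemma map_alphaSeries (f : S →+* R) (c a : Fin d → S) (v : ℕ → S) :
    PowerSeries.map f (alphaSeries c a v) =
      alphaSeries (fun i => f (c i)) (fun i => f (a i)) (fun i => f (v i)) := by
  simp [alphaSeries, map_mk, ← Polynomial.polynomial_map_coe, map_lowPoly, map_monicPoly]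

lemma map_dBetaSeries (f : S →+* R) (c : Fin d → S) (u : ℕ → S) (a : Fin d → S) (v : ℕ → S) :
    PowerSeries.map f (dBetaSeries c u a v) =
      dBetaSeries (fun i => f (c i)) (fun i => f (u i)) (fun i => f (a i)) (fun i => f (v i)) := by
  simp [dBetaSeries, map_mk, ← Polynomial.polynomial_map_coe, map_lowPoly, map_monicPoly]

lemma map_betaSeries (f : S →+* R) (c : Fin d → S) (u : ℕ → S) :
    PowerSeries.map f (betaSeries c u) =
      betaSeries (fun i => f (c i)) (fun i => f (u i)) := by
  simp [betaSeries, map_mk, ← Polynomial.polynomial_map_coe, map_monicPoly]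

lemma map_alphaJet {n : ℕ} (f : S →+* R) (c a : Fin d → S) (v : Fin (n + 1) → S) :
    (alphaJet c a v).map f =
      alphaJet (fun i => f (c i)) (fun i => f (a i)) (fun i => f (v i)) := by
  simp [alphaJet, map_lowPoly, map_monicPoly]

variable (k : Type u) [Field k] (d)

/-- On `R`-points, `α_d (q, a, v) = (q, q v + a)`. -/
lemma fiberMap_alpha {R : Type v} [CommRing R] (s : CoordQ k d →+* R) (w : Fin d ⊕ ℕ → R)
    (n : ℕ) :
    fiberMap (alpha k d) s w n = PowerSeries.coeff n
      (alphaSeries (fun i => s (MvPolynomial.X i)) (fun i => w (Sum.inl i))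
        (fun j => w (Sum.inr j))) := by
  have h := map_alphaSeries (MvPolynomial.eval₂Hom s w)
    (fun i : Fin d => (MvPolynomial.C (MvPolynomial.X i) : CoordQAL k d))
    (fun i => MvPolynomial.X (Sum.inl i)) (fun j => MvPolynomial.X (Sum.inr j))
  have h' := congrArg (PowerSeries.coeff n) h
  simpa [fiberMap, alpha] using h'

/-- On `R`-points, `α_{d,n} (q, a, v) = (q, q v + a)`. -/
lemma fiberMap_alphaN (n : ℕ) {R : Type v} [CommRing R] (s : CoordQ k d →+* R)
    (w : Fin d ⊕ Fin (n + 1) → R) (i : Fin (n + 1)) :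
    fiberMap (alphaN k d n) s w i =
      (alphaJet (fun i => s (MvPolynomial.X i)) (fun i => w (Sum.inl i))
        (fun j => w (Sum.inr j))).coeff (i : ℕ) := by
  have h := map_alphaJet (MvPolynomial.eval₂Hom s w)
    (fun i : Fin d => (MvPolynomial.C (MvPolynomial.X i) :
      MvPolynomial (Fin d ⊕ Fin (n + 1)) (CoordQ k d)))
    (fun i => MvPolynomial.X (Sum.inl i)) (fun j => MvPolynomial.X (Sum.inr j))
  have h' := congrArg (fun p => Polynomial.coeff p (i : ℕ)) h
  simpa [fiberMap, alphaN] using h'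

/-- On `R`-points, `dβ_d (q, u, a, v) = (q, u, u a + q v)`. -/
lemma fiberMap_dBeta {R : Type v} [CommRing R] (s : CoordQG k d →+* R) (w : Fin d ⊕ ℕ → R)
    (n : ℕ) :
    fiberMap (dBeta k d) s w n = PowerSeries.coeff n
      (dBetaSeries (fun i => s (coordq k d i)) (fun j => s (coordu k d j))
        (fun i => w (Sum.inl i)) (fun j => w (Sum.inr j))) := by
  have h := map_dBetaSeries (MvPolynomial.eval₂Hom s w)
    (fun i : Fin d => (MvPolynomial.C (coordq k d i) : CoordTX k d))
    (fun j => MvPolynomial.C (coordu k d j))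
    (fun i => MvPolynomial.X (Sum.inl i)) (fun j => MvPolynomial.X (Sum.inr j))
  have h' := congrArg (PowerSeries.coeff n) h
  simpa [fiberMap, dBeta] using h'

/-- `TX (R) = X (R[ε])` for `X = Q_d × L𝔾_m`: a point of `X` over the dual numbers is the same as
a point of `X` over `R` together with a vector `(a, v)`. -/
lemma exists_unique_tangent {R : Type v} [CommRing R] [Algebra k R] (x : CoordQG k d →ₐ[k] R)
    (w : Fin d ⊕ ℕ → R) :
    ∃! τ : CoordQG k d →ₐ[k] DualNumber R,
      (∀ z, (τ z).fst = x z) ∧ (∀ i, (τ (coordq k d i)).snd = w (Sum.inl i)) ∧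
        ∀ j, (τ (coordu k d j)).snd = w (Sum.inr j) := by
  have hfst : ∀ τ : CoordQG k d →ₐ[k] DualNumber R, ∀ z, (τ z).fst =
      ((TrivSqZeroExt.fstHom k R R).comp τ) z := fun _ _ => rfl
  let p : Fin d ⊕ ℕ → DualNumber R := fun i =>
    TrivSqZeroExt.inl (x (algebraMap (MvPolynomial (Fin d ⊕ ℕ) k) (CoordQG k d)
      (MvPolynomial.X i))) + TrivSqZeroExt.inr (w i)
  let g : MvPolynomial (Fin d ⊕ ℕ) k →ₐ[k] DualNumber R := MvPolynomial.aeval p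
  have hu : IsUnit (g (MvPolynomial.X (Sum.inr 0))) := by
    rw [TrivSqZeroExt.isUnit_iff_isUnit_fst]
    have h1 : IsUnit (algebraMap (MvPolynomial (Fin d ⊕ ℕ) k) (CoordQG k d)
        (MvPolynomial.X (Sum.inr 0))) := IsLocalization.Away.algebraMap_isUnit _
    simpa [g, p] using h1.map x
  have hS : ∀ y : Submonoid.powers (MvPolynomial.X (Sum.inr 0) : MvPolynomial (Fin d ⊕ ℕ) k),
      IsUnit (g y) := by
    rintro ⟨_, m, rfl⟩
    simpa using hu.pow m
  have hgX : ∀ i, (IsLocalization.liftAlgHom (M := Submonoid.powers (MvPolynomial.X (Sum.inr 0) :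
      MvPolynomial (Fin d ⊕ ℕ) k)) (S := CoordQG k d) hS)
        (algebraMap (MvPolynomial (Fin d ⊕ ℕ) k) (CoordQG k d) (MvPolynomial.X i)) = p i := by
    intro i
    simp [g]
  refine ⟨IsLocalization.liftAlgHom (M := Submonoid.powers (MvPolynomial.X (Sum.inr 0) :
    MvPolynomial (Fin d ⊕ ℕ) k)) (S := CoordQG k d) hS, ⟨?_, ?_, ?_⟩, ?_⟩
  · intro z
    rw [hfst]
    refine DFunLike.congr_fun ?_ z
    refine IsLocalization.algHom_ext (Submonoid.powers (MvPolynomial.X (Sum.inr 0) :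
      MvPolynomial (Fin d ⊕ ℕ) k)) ?_
    refine MvPolynomial.algHom_ext fun i => ?_
    refine (congrArg TrivSqZeroExt.fst (hgX i)).trans ?_
    simp [p]
    rfl
  · intro i
    have := congrArg TrivSqZeroExt.snd (hgX (Sum.inl i))
    simpa [p, coordq] using this
  · intro i
    have := congrArg TrivSqZeroExt.snd (hgX (Sum.inr i))
    simpa [p, coordu] using this
  · rintro τ ⟨h1, h2, h3⟩
    refine IsLocalization.algHom_ext (Submonoid.powers (MvPolynomial.X (Sum.inr 0) :
      MvPolynomial (Fin d ⊕ ℕ) k)) ?_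
    refine MvPolynomial.algHom_ext fun i => ?_
    refine Eq.trans ?_ (hgX i).symm
    refine TrivSqZeroExt.ext ?_ ?_
    · refine (h1 (algebraMap (MvPolynomial (Fin d ⊕ ℕ) k) (CoordQG k d)
        (MvPolynomial.X i))).trans ?_
      simp [p]
    · rcases i with i | i
      · refine (h2 i).trans ?_
        simp [p]
      · refine (h3 i).trans ?_
        simp [p]

/-- Under `TX (R) = X (R[ε])`, the morphism `dβ_d` is the one induced by `β_d`. -/
lemma snd_beta {R : Type v} [CommRing R] [Algebra k R] (τ : CoordQG k d →ₐ[k] DualNumber R)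
    (n : ℕ) :
    (τ (beta k d (MvPolynomial.X n))).snd =
      fiberMap (dBeta k d) (((TrivSqZeroExt.fstHom k R R).comp τ : CoordQG k d →ₐ[k] R) :
          CoordQG k d →+* R)
        (Sum.elim (fun i => (τ (coordq k d i)).snd) (fun j => (τ (coordu k d j)).snd)) n := by
  have hb : τ (beta k d (MvPolynomial.X n)) = PowerSeries.coeff n
      (betaSeries (fun i => τ (coordq k d i)) (fun j => τ (coordu k d j))) := by
    have h := congrArg (PowerSeries.coeff n)
      (map_betaSeries (τ : CoordQG k d →+* DualNumber R) (coordq k d) (coordu k d))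
    simpa [beta] using h
  have hlow : ∀ (c : Fin d → DualNumber R) (m : ℕ),
      ((lowPoly c).coeff m).fst = (lowPoly fun i => (c i).fst).coeff m ∧
      ((lowPoly c).coeff m).snd = (lowPoly fun i => (c i).snd).coeff m := by
    intro c m
    constructor
    · simp [lowPoly, Polynomial.coeff_X_pow, apply_ite,
        TrivSqZeroExt.fst_sum]
    · simp [lowPoly, Polynomial.coeff_X_pow, apply_ite,
        TrivSqZeroExt.snd_sum]
  have hmon : ∀ (c : Fin d → DualNumber R) (m : ℕ),
      ((monicPoly c).coeff m).fst = (monicPoly fun i => (c i).fst).coeff m ∧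
      ((monicPoly c).coeff m).snd = (lowPoly fun i => (c i).snd).coeff m := by
    intro c m
    constructor
    · by_cases h : m = d <;> simp [monicPoly, Polynomial.coeff_X_pow, h, hlow]
    · by_cases h : m = d <;> simp [monicPoly, Polynomial.coeff_X_pow, h, hlow]
  rw [hb, fiberMap_dBeta, betaSeries, dBetaSeries, mul_comm (PowerSeries.mk _)]
  simp only [map_add, PowerSeries.coeff_mul, PowerSeries.coeff_mk, Polynomial.coeff_coe,
    TrivSqZeroExt.snd_sum, ← Finset.sum_add_distrib]
  refine Finset.sum_congr rfl fun x _ => ?_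
  simp [hmon, mul_comm, add_comm]

end Points

end WeierstrassDivision

end

noncomputable section

namespace WeierstrassDivision

/-! ### Weierstrass division of power series modulo a nilpotent ideal. -/

section Series

variable {R : Type*} [CommRing R]

/-! Both morphisms have the form `(a, v) ↦ u a + q v` over a base carrying `q` and `u`, with `u`
invertible and `u = 1` for `α_d`. This common form is `divisionMap`, and each assertion about it
amounts to solving `u a + q v = w` over some ring, that is, to dividing `u⁻¹ w` by `q`.

At a point `x` the monic polynomial `q` reduces to a polynomial of some order `r ≤ d` over the
residue field. Over a ring receiving a formal point at `x`, the coefficients of `q` below `t ^ r`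
are therefore nilpotent and the `r`-th one is a unit, so `q = p + t ^ r e` with `e` invertible and
`p` small. Division by `t ^ r e` is just splitting a series at degree `r`; the error it makes for
`q` is multiplied by `p` at each iteration and dies by nilpotence (`exists_division`). Over a field
`p = 0`, whence surjectivity on points.

The division stays inside any ideal `I` containing the coefficients of `w`. Hence a solution modulo
a nilpotent `I` lifts: lift it arbitrarily and divide the defect (`exists_lift_dBetaSeries`). This
is formal smoothness.

The remainder is unique among series of degree less than `r`, whereas `a` ranges over degree less
than `d`. The two conditions agree when `r = d`, that is, when `q` is `t ^ d` at `x`; then the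
solution is unique and the completion map is bijective. -/

lemma coeff_mul_mem_mul {I J : Ideal R} {f g : PowerSeries R}
    (hf : ∀ n, PowerSeries.coeff n f ∈ I) (hg : ∀ n, PowerSeries.coeff n g ∈ J) (n : ℕ) :
    PowerSeries.coeff n (f * g) ∈ I * J := by
  rw [PowerSeries.coeff_mul]
  exact Ideal.sum_mem _ fun p _ => Ideal.mul_mem_mul (hf _) (hg _)

lemma coeff_mul_mem_left {I : Ideal R} (f : PowerSeries R) {g : PowerSeries R}
    (hg : ∀ n, PowerSeries.coeff n g ∈ I) (n : ℕ) : PowerSeries.coeff n (f * g) ∈ I := by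
  rw [PowerSeries.coeff_mul]
  exact Ideal.sum_mem _ fun p _ => Ideal.mul_mem_left _ _ (hg _)

lemma exists_eq_add_X_pow_mul (I : Ideal R) (r : ℕ) (f : PowerSeries R)
    (hf : ∀ i < r, PowerSeries.coeff i f ∈ I) :
    ∃ a : PowerSeries R, (∀ n, PowerSeries.coeff n a ∈ I) ∧
      (∀ n, r ≤ n → PowerSeries.coeff n a = 0) ∧
      f = a + PowerSeries.X ^ r * PowerSeries.mk fun n => PowerSeries.coeff (n + r) f := by
  refine ⟨(f.trunc r : PowerSeries R), fun n => ?_, fun n hn => ?_, ?_⟩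
  · rw [Polynomial.coeff_coe, PowerSeries.coeff_trunc]
    split_ifs with h
    · exact hf n h
    · exact I.zero_mem
  · rw [Polynomial.coeff_coe, PowerSeries.coeff_trunc, if_neg (not_lt.mpr hn)]
  · ext n
    rw [map_add, Polynomial.coeff_coe, PowerSeries.coeff_trunc, PowerSeries.coeff_X_pow_mul']
    by_cases h : n < r
    · simp [h]
    · simp [h, not_lt.mp h]

/-- A series of order `r` modulo `J` is the sum of `t ^ r` times a unit and of a series with
coefficients in `J`. -/
lemma exists_eq_add_X_pow_mul_unit {J : Ideal R} {r : ℕ} {q : PowerSeries R}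
    (hlow : ∀ i < r, PowerSeries.coeff i q ∈ J) (hr : IsUnit (PowerSeries.coeff r q)) :
    ∃ p e e' : PowerSeries R, (∀ n, PowerSeries.coeff n p ∈ J) ∧ e * e' = 1 ∧
      q = p + PowerSeries.X ^ r * e := by
  obtain ⟨p, hp, -, h⟩ := exists_eq_add_X_pow_mul J r q hlow
  have heu : IsUnit (PowerSeries.mk fun n => PowerSeries.coeff (n + r) q) := by
    rw [PowerSeries.isUnit_iff_constantCoeff]
    simpa using hr
  obtain ⟨e', he'⟩ := heu.exists_right_inv
  exact ⟨p, _, e', hp, he', h⟩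

/-- Weierstrass division of series with coefficients in `I`, by a series that has order `r` modulo
a nilpotent ideal. -/
lemma exists_division {J : Ideal R} (hJ : IsNilpotent J) {r : ℕ} {q : PowerSeries R}
    (hlow : ∀ i < r, PowerSeries.coeff i q ∈ J) (hr : IsUnit (PowerSeries.coeff r q))
    (I : Ideal R) (w : PowerSeries R) (hw : ∀ n, PowerSeries.coeff n w ∈ I) :
    ∃ v a : PowerSeries R, (∀ n, PowerSeries.coeff n v ∈ I) ∧ (∀ n, PowerSeries.coeff n a ∈ I) ∧
      (∀ n, r ≤ n → PowerSeries.coeff n a = 0) ∧ w = q * v + a := by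
  obtain ⟨N, hN⟩ := hJ
  obtain ⟨p, e, e', hpJ, hee', hq⟩ := exists_eq_add_X_pow_mul_unit hlow hr
  have hI : I * J ^ N = ⊥ := by
    rw [hN, Ideal.zero_eq_bot, Ideal.mul_bot]
  clear hN hlow hr
  -- Each round replaces `I` by `I * J`, so the exponent `N` with `I * J ^ N = ⊥` drops by one; at
  -- `N = 0` the series `w` is zero.
  induction N generalizing I w with
  | zero =>
    have hI' : I = ⊥ := by simpa using hI
    refine ⟨0, 0, by simp, by simp, by simp, ?_⟩
    ext n
    simpa [hI'] using hw n
  | succ m ih =>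
    obtain ⟨a₁, ha₁, har₁, hww⟩ := exists_eq_add_X_pow_mul I r w fun i _ => hw i
    generalize hw' : (PowerSeries.mk fun n => PowerSeries.coeff (n + r) w) = w' at hww
    have hv₁ : ∀ n, PowerSeries.coeff n (e' * w') ∈ I :=
      coeff_mul_mem_left _ fun n => by
        rw [← hw', PowerSeries.coeff_mk]
        exact hw (n + r)
    -- With trial quotient `e' * w'` the term `t ^ r e` of `q` reproduces `t ^ r w'` exactly; only
    -- `-p e' w'` is left to divide.
    have hrem : ∀ n, PowerSeries.coeff n (-(p * (e' * w'))) ∈ I * J := by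
      intro n
      rw [map_neg, mul_comm I J]
      exact neg_mem (coeff_mul_mem_mul hpJ hv₁ n)
    obtain ⟨v, a, hv, ha, har, hva⟩ := ih (I * J) _ hrem (by rw [mul_assoc, ← pow_succ', hI])
    have hle : I * J ≤ I := Ideal.mul_le_left
    refine ⟨e' * w' + v, a₁ + a, fun n => ?_, fun n => ?_, fun n hn => ?_, ?_⟩
    · rw [map_add]
      exact add_mem (hv₁ n) (hle (hv n))
    · rw [map_add]
      exact add_mem (ha₁ n) (hle (ha n))
    · rw [map_add, har n hn, har₁ n hn, add_zero]
    · linear_combination hww - (PowerSeries.X ^ r * w') * hee' + hva - (e' * w') * hq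

/-- Uniqueness of Weierstrass division by a series that has order `r` modulo a nilpotent ideal. -/
lemma division_unique {J : Ideal R} (hJ : IsNilpotent J) {r : ℕ} {q : PowerSeries R}
    (hlow : ∀ i < r, PowerSeries.coeff i q ∈ J) (hr : IsUnit (PowerSeries.coeff r q))
    {v a : PowerSeries R} (ha : ∀ n, r ≤ n → PowerSeries.coeff n a = 0) (h : q * v + a = 0) :
    v = 0 ∧ a = 0 := by
  suffices hv : v = 0 by
    refine ⟨hv, ?_⟩
    simpa [hv] using h
  obtain ⟨N, hN⟩ := hJ
  obtain ⟨p, e, e', hpJ, hee', hq⟩ := exists_eq_add_X_pow_mul_unit hlow hr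
  -- In degrees at least `r` the series `a` vanishes, so there `t ^ r e v` equals `-p v`: each
  -- comparison gains a factor `J`.
  have key : ∀ m : ℕ, ∀ n, PowerSeries.coeff n v ∈ J ^ m := by
    intro m
    induction m with
    | zero => simp
    | succ m ih =>
      have hev : ∀ n, PowerSeries.coeff n (e * v) ∈ J ^ (m + 1) := by
        intro n
        have h1 : PowerSeries.X ^ r * (e * v) + a = -(p * v) := by
          linear_combination h - v * hq
        have h3 := congrArg (PowerSeries.coeff (n + r)) h1
        rw [map_add, PowerSeries.coeff_X_pow_mul, ha _ (Nat.le_add_left r n), add_zero,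
          map_neg] at h3
        rw [h3, pow_succ']
        exact neg_mem (coeff_mul_mem_mul hpJ ih _)
      have : v = e' * (e * v) := by linear_combination -v * hee'
      intro n
      rw [this]
      exact coeff_mul_mem_left _ hev n
  ext n
  simpa [hN] using key N n

/-! ### The equation `u a + q v = w` over a ring. -/

variable {d : ℕ}

lemma coeff_lowPoly (c : Fin d → R) (n : ℕ) :
    (lowPoly c).coeff n = if h : n < d then c ⟨n, h⟩ else 0 := by
  simp only [lowPoly, Polynomial.finsetSum_coeff, Polynomial.coeff_C_mul, Polynomial.coeff_X_pow]
  split_ifs with h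
  · rw [Finset.sum_eq_single (⟨n, h⟩ : Fin d)]
    · simp
    · intro i _ hi
      have : n ≠ i := fun h' => hi (Fin.ext h'.symm)
      simp [this]
    · simp
  · refine Finset.sum_eq_zero fun i _ => ?_
    have : n ≠ i := fun h' => h (h' ▸ i.2)
    simp [this]

lemma coeff_monicPoly_of_lt (c : Fin d → R) {n : ℕ} (h : n < d) :
    (monicPoly c).coeff n = c ⟨n, h⟩ := by
  simp [monicPoly, coeff_lowPoly, h, Polynomial.coeff_X_pow, h.ne]

lemma coeff_monicPoly_self (c : Fin d → R) : (monicPoly c).coeff d = 1 := by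
  simp [monicPoly, coeff_lowPoly]

lemma eq_lowPoly_of_coeff_eq_zero {a : PowerSeries R}
    (ha : ∀ n, d ≤ n → PowerSeries.coeff n a = 0) :
    (lowPoly (fun i : Fin d => PowerSeries.coeff (i : ℕ) a) : PowerSeries R) = a := by
  ext n
  rw [Polynomial.coeff_coe, coeff_lowPoly]
  split_ifs with h
  · rfl
  · exact (ha n (not_lt.mp h)).symm

lemma mk_coeff (f : PowerSeries R) : PowerSeries.mk (fun n => PowerSeries.coeff n f) = f := by
  ext; simp

lemma lowPoly_add (a b : Fin d → R) : lowPoly (a + b) = lowPoly a + lowPoly b := by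
  simp [lowPoly, add_mul, Finset.sum_add_distrib]

lemma lowPoly_smul (r : R) (a : Fin d → R) : lowPoly (r • a) = Polynomial.C r * lowPoly a := by
  simp [lowPoly, Finset.mul_sum, mul_assoc]

lemma isUnit_mk {u : ℕ → R} (hu : IsUnit (u 0)) : IsUnit (PowerSeries.mk u) := by
  rw [PowerSeries.isUnit_iff_constantCoeff]
  simpa using hu

lemma dBetaSeries_add (c : Fin d → R) (u : ℕ → R) (a a' : Fin d → R) (v v' : ℕ → R) :
    dBetaSeries c u (a + a') (v + v') = dBetaSeries c u a v + dBetaSeries c u a' v' := by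
  have : PowerSeries.mk (v + v') = PowerSeries.mk v + PowerSeries.mk v' := by ext; simp
  rw [dBetaSeries, dBetaSeries, dBetaSeries, lowPoly_add, this, Polynomial.coe_add]
  ring

/-- Divide `u⁻¹ w` by `q` and multiply back by `u`: the remainder is `a` and `u` times the quotient
is `v`. The ideal `I` is kept for the lifting argument; `I = ⊤` gives plain solvability. -/
lemma exists_dBetaSeries_eq {J : Ideal R} (hJ : IsNilpotent J) {r : ℕ} (hrd : r ≤ d)
    {c : Fin d → R} {u : ℕ → R} (hu : IsUnit (u 0))
    (hlow : ∀ i < r, (monicPoly c).coeff i ∈ J) (hr : IsUnit ((monicPoly c).coeff r))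
    (I : Ideal R) (w : PowerSeries R) (hw : ∀ n, PowerSeries.coeff n w ∈ I) :
    ∃ (a : Fin d → R) (v : ℕ → R), dBetaSeries c u a v = w ∧ (∀ i, a i ∈ I) ∧ ∀ j, v j ∈ I := by
  obtain ⟨u', hu'⟩ := (isUnit_mk hu).exists_right_inv
  obtain ⟨v, a, hv, ha, har, hva⟩ := exists_division hJ
    (q := (monicPoly c : PowerSeries R)) (by simpa using hlow) (by simpa using hr) I (u' * w)
    (coeff_mul_mem_left _ hw)
  refine ⟨fun i => PowerSeries.coeff (i : ℕ) a,
    fun j => PowerSeries.coeff j (PowerSeries.mk u * v), ?_, fun i => ha i,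
    coeff_mul_mem_left _ hv⟩
  rw [dBetaSeries, mk_coeff, eq_lowPoly_of_coeff_eq_zero fun n hn => har n (hrd.trans hn)]
  calc _ = PowerSeries.mk u * ((monicPoly c : PowerSeries R) * v + a) := by ring
    _ = PowerSeries.mk u * u' * w := by rw [← hva, mul_assoc]
    _ = w := by rw [hu', one_mul]

/-- Solutions of `u a + q v = w` lift along nilpotent thickenings. -/
lemma exists_lift_dBetaSeries {J : Ideal R} (hJ : IsNilpotent J) {r : ℕ} (hrd : r ≤ d)
    {c : Fin d → R} {u : ℕ → R} (hu : IsUnit (u 0))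
    (hlow : ∀ i < r, (monicPoly c).coeff i ∈ J) (hr : IsUnit ((monicPoly c).coeff r))
    (I : Ideal R) (w : PowerSeries R) (a₀ : Fin d → R ⧸ I) (v₀ : ℕ → R ⧸ I)
    (h : dBetaSeries (fun i => Ideal.Quotient.mk I (c i)) (fun j => Ideal.Quotient.mk I (u j))
      a₀ v₀ = PowerSeries.map (Ideal.Quotient.mk I) w) :
    ∃ (a : Fin d → R) (v : ℕ → R), dBetaSeries c u a v = w ∧
      (∀ i, Ideal.Quotient.mk I (a i) = a₀ i) ∧ ∀ j, Ideal.Quotient.mk I (v j) = v₀ j := by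
  -- Any coefficientwise lift solves the equation up to a defect with coefficients in `I`; dividing
  -- that defect gives a correction that is itself in `I`.
  choose a₁ ha₁ using fun i => Ideal.Quotient.mk_surjective (a₀ i)
  choose v₁ hv₁ using fun j => Ideal.Quotient.mk_surjective (v₀ j)
  have hI : ∀ n, PowerSeries.coeff n (w - dBetaSeries c u a₁ v₁) ∈ I := by
    intro n
    rw [← Ideal.Quotient.eq_zero_iff_mem, ← PowerSeries.coeff_map, map_sub, map_dBetaSeries]
    simp [ha₁, hv₁, ← h]
  obtain ⟨a, v, hav, ha, hv⟩ := exists_dBetaSeries_eq hJ hrd hu hlow hr I _ hI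
  refine ⟨a₁ + a, v₁ + v, ?_, fun i => ?_, fun j => ?_⟩
  · rw [dBetaSeries_add, hav]
    ring
  · simp [ha₁, Ideal.Quotient.eq_zero_iff_mem.mpr (ha i)]
  · simp [hv₁, Ideal.Quotient.eq_zero_iff_mem.mpr (hv j)]

/-- By linearity it suffices to treat the zero right-hand side. After multiplication by `u⁻¹` this
is uniqueness of division with `r = d`, available because all lower coefficients of `q` lie in `J`.
-/
lemma dBetaSeries_injective {J : Ideal R} (hJ : IsNilpotent J)
    {c : Fin d → R} {u : ℕ → R} (hu : IsUnit (u 0)) (hc : ∀ i, c i ∈ J)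
    {a a' : Fin d → R} {v v' : ℕ → R} (h : dBetaSeries c u a v = dBetaSeries c u a' v') :
    a = a' ∧ v = v' := by
  obtain ⟨u', hu'⟩ := (isUnit_mk hu).exists_left_inv
  have h0 : dBetaSeries c u (a - a') (v - v') = 0 := by
    have := dBetaSeries_add c u (a - a') a' (v - v') v'
    simpa [h] using this
  have h1 : (monicPoly c : PowerSeries R) * (u' * PowerSeries.mk (v - v')) +
      (lowPoly (a - a') : PowerSeries R) = 0 := by
    calc _ = (monicPoly c : PowerSeries R) * (u' * PowerSeries.mk (v - v')) +
        (u' * PowerSeries.mk u) * (lowPoly (a - a') : PowerSeries R) := by rw [hu', one_mul]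
      _ = u' * dBetaSeries c u (a - a') (v - v') := by rw [dBetaSeries]; ring
      _ = 0 := by rw [h0, mul_zero]
  obtain ⟨h2, h3⟩ := division_unique hJ (r := d)
    (fun i hi => by simpa [coeff_monicPoly_of_lt c hi] using hc ⟨i, hi⟩)
    (by simp [coeff_monicPoly_self])
    (fun n hn => by simp [coeff_lowPoly, not_lt.mpr hn]) h1
  constructor
  · funext i
    have := congrArg (PowerSeries.coeff (i : ℕ)) h3
    simpa [coeff_lowPoly, sub_eq_zero] using this
  · have h4 : PowerSeries.mk (v - v') = 0 := by
      have := congrArg (PowerSeries.mk u * ·) h2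
      simpa [← mul_assoc, mul_comm _ u', hu'] using this
    funext j
    have := congrArg (PowerSeries.coeff j) h4
    simpa [sub_eq_zero] using this

/-- The order of `q` at the point `x`; it is at most `d` because `q` is monic. -/
lemma exists_first_coeff_notMem (x : Ideal R) [x.IsPrime] (c : Fin d → R) :
    ∃ r ≤ d, (∀ i < r, (monicPoly c).coeff i ∈ x) ∧ (monicPoly c).coeff r ∉ x := by
  classical
  have hex : ∃ r, (monicPoly c).coeff r ∉ x :=
    ⟨d, by rw [coeff_monicPoly_self]; exact x.ne_top_iff_one.mp Ideal.IsPrime.ne_top'⟩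
  refine ⟨Nat.find hex, Nat.find_min' hex ?_, fun i hi => ?_, Nat.find_spec hex⟩
  · rw [coeff_monicPoly_self]
    exact x.ne_top_iff_one.mp Ideal.IsPrime.ne_top'
  · exact not_not.mp (Nat.find_min hex hi)

lemma exists_dBetaSeries_eq_of_field {K : Type*} [Field K] (c : Fin d → K) (u : ℕ → K)
    (hu : u 0 ≠ 0) (w : PowerSeries K) :
    ∃ (a : Fin d → K) (v : ℕ → K), dBetaSeries c u a v = w := by
  obtain ⟨r, hrd, hlow, hr⟩ := exists_first_coeff_notMem (⊥ : Ideal K) c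
  obtain ⟨a, v, h, -⟩ := exists_dBetaSeries_eq (J := ⊥) ⟨1, by simp⟩ hrd hu.isUnit hlow
    (Ne.isUnit (by simpa using hr)) ⊤ w (by simp)
  exact ⟨a, v, h⟩

lemma alphaSeries_eq_dBetaSeries (c a : Fin d → R) (v : ℕ → R) :
    alphaSeries c a v = dBetaSeries c (Pi.single 0 1) a v := by
  have : PowerSeries.mk (Pi.single 0 1 : ℕ → R) = 1 := by
    ext n
    simp [PowerSeries.coeff_one, Pi.single_apply]
  rw [alphaSeries, dBetaSeries, this]
  ring

end Series

/-! ### Points of formal completions. -/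

section Completion

variable {A : Type u} [CommRing A]

/-- A homomorphism that maps a prime `x` into a nilpotent ideal and the complement of `x` to units
is a point of the formal completion at `x`. -/
lemma exists_formalPt {R : Type u} [CommRing R] (x : PrimeSpectrum A) (f : A →+* R) {J : Ideal R}
    (hJ : IsNilpotent J) (hx : ∀ z ∈ x.asIdeal, f z ∈ J)
    (hu : ∀ z, z ∉ x.asIdeal → IsUnit (f z)) :
    ∃ F : FormalPt (Localization.AtPrime x.asIdeal) R,
      ∀ z, F.1 (algebraMap A _ z) = f z := by
  obtain ⟨n, hn⟩ := hJ
  let F : Localization.AtPrime x.asIdeal →+* R :=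
    IsLocalization.lift (M := x.asIdeal.primeCompl) (g := f) fun y => hu y y.2
  have hF : ∀ z, F (algebraMap A _ z) = f z := fun z => IsLocalization.lift_eq _ z
  refine ⟨⟨F, n, ?_⟩, hF⟩
  have h1 : Ideal.map F (IsLocalRing.maximalIdeal (Localization.AtPrime x.asIdeal)) ≤ J := by
    rw [← Localization.AtPrime.map_eq_maximalIdeal, Ideal.map_map, Ideal.map_le_iff_le_comap]
    intro z hz
    simpa [hF] using hx z hz
  intro z hz
  have h2 := Ideal.pow_right_mono h1 n (Ideal.map_pow F _ n ▸ Ideal.mem_map_of_mem F hz)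
  rw [hn] at h2
  simpa using h2

lemma FormalPt.ext_algebraMap {R : Type u} [CommRing R] {x : PrimeSpectrum A}
    {F G : FormalPt (Localization.AtPrime x.asIdeal) R}
    (h : F.1.comp (algebraMap A _) = G.1.comp (algebraMap A _)) : F = G :=
  Subtype.ext (IsLocalization.ringHom_ext x.asIdeal.primeCompl h)

/-- The ideal generated by the image of the maximal ideal under a point of a formal completion
is nilpotent. -/
lemma FormalPt.isNilpotent_map {R : Type u} [CommRing R] {O : Type u} [CommRing O] [IsLocalRing O]
    (F : FormalPt O R) : IsNilpotent (Ideal.map F.1 (IsLocalRing.maximalIdeal O)) := by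
  obtain ⟨n, hn⟩ := F.2
  refine ⟨n, ?_⟩
  rw [← Ideal.map_pow, Ideal.zero_eq_bot, eq_bot_iff, Ideal.map_le_iff_le_comap]
  exact hn

lemma FormalPt.algebraMap_mem_map {R : Type u} [CommRing R] {x : PrimeSpectrum A}
    (F : FormalPt (Localization.AtPrime x.asIdeal) R) {z : A} (hz : z ∈ x.asIdeal) :
    F.1 (algebraMap A _ z) ∈
      Ideal.map F.1 (IsLocalRing.maximalIdeal (Localization.AtPrime x.asIdeal)) := by
  refine Ideal.mem_map_of_mem _ ?_
  rw [← Localization.AtPrime.map_eq_maximalIdeal]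
  exact Ideal.mem_map_of_mem _ hz

lemma FormalPt.isUnit_algebraMap {R : Type u} [CommRing R] {x : PrimeSpectrum A}
    (F : FormalPt (Localization.AtPrime x.asIdeal) R) {z : A} (hz : z ∉ x.asIdeal) :
    IsUnit (F.1 (algebraMap A _ z)) :=
  (IsLocalization.map_units (Localization.AtPrime x.asIdeal)
    (⟨z, hz⟩ : x.asIdeal.primeCompl)).map F.1

lemma completionMap_algebraMap {B : Type u} [CommRing B] (φ : B →+* A) (x : PrimeSpectrum A)
    {R : Type u} [CommRing R] (F : FormalPt (Localization.AtPrime x.asIdeal) R) (b : B) :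
    (completionMap φ x R F).1 (algebraMap B _ b) = F.1 (algebraMap A _ (φ b)) := by
  change F.1 (Localization.localRingHom _ _ _ _ _) = _
  rw [Localization.localRingHom_to_map]

lemma isNilpotent_comap_mk {R : Type*} [CommRing R] {I : Ideal R} (hI : IsNilpotent I)
    {J : Ideal (R ⧸ I)} (hJ : IsNilpotent J) : IsNilpotent (J.comap (Ideal.Quotient.mk I)) := by
  obtain ⟨m, hm⟩ := hI
  obtain ⟨n, hn⟩ := hJ
  refine ⟨n * m, ?_⟩
  have h : J.comap (Ideal.Quotient.mk I) ^ n ≤ I := by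
    refine (Ideal.le_comap_pow (Ideal.Quotient.mk I) n).trans ?_
    rw [hn, Ideal.zero_eq_bot, ← RingHom.ker_eq_comap_bot, Ideal.mk_ker]
  rw [pow_mul, Ideal.zero_eq_bot, eq_bot_iff, ← Ideal.zero_eq_bot, ← hm]
  exact Ideal.pow_right_mono h m

end Completion

/-! ### Surjectivity, formal smoothness and isomorphism for `(a, v) ↦ u a + q v`. -/

section DivisionMap

variable {S : Type u} [CommRing S] {d : ℕ}

/-- The morphism `(a, v) ↦ u a + q v` of trivial vector bundles over `Spec S`. -/
def divisionMap (c : Fin d → S) (u : ℕ → S) :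
    MvPolynomial ℕ S →ₐ[S] MvPolynomial (Fin d ⊕ ℕ) S :=
  MvPolynomial.aeval fun n => PowerSeries.coeff n
    (dBetaSeries (fun i => MvPolynomial.C (c i)) (fun j => MvPolynomial.C (u j))
      (fun i => MvPolynomial.X (Sum.inl i)) (fun j => MvPolynomial.X (Sum.inr j)))

variable (c : Fin d → S) (u : ℕ → S)

lemma map_divisionMap_X {R : Type*} [CommRing R] (f : MvPolynomial (Fin d ⊕ ℕ) S →+* R) (n : ℕ) :
    f (divisionMap c u (MvPolynomial.X n)) = PowerSeries.coeff n
      (dBetaSeries (fun i => f (MvPolynomial.C (c i))) (fun j => f (MvPolynomial.C (u j)))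
        (fun i => f (MvPolynomial.X (Sum.inl i))) (fun j => f (MvPolynomial.X (Sum.inr j)))) := by
  rw [divisionMap, MvPolynomial.aeval_X, ← PowerSeries.coeff_map, map_dBetaSeries]

lemma divisionMap_C (s : S) : divisionMap c u (MvPolynomial.C s) = MvPolynomial.C s :=
  (divisionMap c u).commutes s

/-- Homomorphisms that extend `g` along `divisionMap c u` are the solutions of `u a + q v = w`. -/
lemma eval₂Hom_comp_divisionMap {R : Type*} [CommRing R] (g : MvPolynomial ℕ S →+* R)
    {a : Fin d → R} {v : ℕ → R}
    (h : dBetaSeries (fun i => g (MvPolynomial.C (c i))) (fun j => g (MvPolynomial.C (u j))) a v =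
      PowerSeries.mk fun n => g (MvPolynomial.X n)) (b : MvPolynomial ℕ S) :
    MvPolynomial.eval₂Hom (g.comp MvPolynomial.C) (Sum.elim a v) (divisionMap c u b) = g b := by
  have : (MvPolynomial.eval₂Hom (g.comp MvPolynomial.C) (Sum.elim a v)).comp
      (divisionMap c u).toRingHom = g := by
    refine MvPolynomial.ringHom_ext (fun s => ?_) fun n => ?_
    · change MvPolynomial.eval₂Hom _ _ (divisionMap c u (MvPolynomial.C s)) = _
      rw [divisionMap_C, MvPolynomial.coe_eval₂Hom, MvPolynomial.eval₂_C, RingHom.comp_apply]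
    · change MvPolynomial.eval₂Hom _ _ (divisionMap c u (MvPolynomial.X n)) = _
      rw [map_divisionMap_X]
      have h' := congrArg (PowerSeries.coeff n) h
      simpa using h'
  exact DFunLike.congr_fun this b

lemma divisionMap_single : divisionMap c (Pi.single 0 1) =
    MvPolynomial.aeval fun n => PowerSeries.coeff n
      (alphaSeries (fun i => (MvPolynomial.C (c i) : MvPolynomial (Fin d ⊕ ℕ) S))
        (fun i => MvPolynomial.X (Sum.inl i)) (fun j => MvPolynomial.X (Sum.inr j))) := by
  have h : (fun j => (MvPolynomial.C ((Pi.single 0 1 : ℕ → S) j) :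
      MvPolynomial (Fin d ⊕ ℕ) S)) = Pi.single 0 1 := by
    funext j
    rcases eq_or_ne j 0 with rfl | hj
    · simp
    · simp [hj]
  simp only [divisionMap, h, alphaSeries_eq_dBetaSeries]

variable {u}

lemma exists_extension_of_field (hu : IsUnit (u 0)) {K : Type*} [Field K]
    (g : MvPolynomial ℕ S →+* K) :
    ∃ f : MvPolynomial (Fin d ⊕ ℕ) S →+* K, ∀ b, f (divisionMap c u b) = g b := by
  obtain ⟨a, v, h⟩ := exists_dBetaSeries_eq_of_field (fun i => g (MvPolynomial.C (c i)))
    (fun j => g (MvPolynomial.C (u j))) ((hu.map (MvPolynomial.C (σ := ℕ))).map g).ne_zero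
    (PowerSeries.mk fun n => g (MvPolynomial.X n))
  exact ⟨_, eval₂Hom_comp_divisionMap c u g h⟩

/-- Extend the map to the residue field of `y`; the kernel of the extension is a prime contracting
to `y`. -/
lemma comap_divisionMap_surjective (hu : IsUnit (u 0)) :
    Function.Surjective (PrimeSpectrum.comap (divisionMap c u).toRingHom) := by
  intro y
  obtain ⟨f, hf⟩ := exists_extension_of_field c hu
    (algebraMap (MvPolynomial ℕ S) y.asIdeal.ResidueField)
  refine ⟨⟨RingHom.ker f, RingHom.ker_isPrime f⟩, ?_⟩
  ext b
  change f (divisionMap c u b) = 0 ↔ _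
  rw [hf, Ideal.algebraMap_residueField_eq_zero]

lemma exists_algHom_extension (hu : IsUnit (u 0)) (k : Type*) [Field k] [Algebra k S]
    {K : Type*} [Field K] [Algebra k K] (y : MvPolynomial ℕ S →ₐ[k] K) :
    ∃ x : MvPolynomial (Fin d ⊕ ℕ) S →ₐ[k] K,
      x.comp ((divisionMap c u).restrictScalars k) = y := by
  obtain ⟨f, hf⟩ := exists_extension_of_field c hu (y : MvPolynomial ℕ S →+* K)
  refine ⟨{ f with commutes' := fun r => ?_ }, AlgHom.ext hf⟩
  -- Scalars of `k` come from the target of the morphism, where `f` is prescribed by `y`.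
  change f (algebraMap k _ r) = _
  have h := hf (algebraMap k _ r)
  rw [← AlgHom.restrictScalars_apply k, AlgHom.commutes] at h
  rw [h]
  exact y.commutes r

/-- A lift of the formal point is a lift of a solution of `u a + q v = w` from `R ⧸ I` to `R`. The
order `r` of `q` at `x` and the preimage `J` of the nilpotent ideal generated by the image of the
maximal ideal make division possible over `R`. -/
theorem formallySmoothOnCompletion_divisionMap (hu : IsUnit (u 0))
    (x : PrimeSpectrum (MvPolynomial (Fin d ⊕ ℕ) S)) :
    FormallySmoothOnCompletion (divisionMap c u).toRingHom x := by
  intro R _ I hI G F₀ hGF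
  set g : MvPolynomial ℕ S →+* R := G.1.comp (algebraMap _ _) with hg
  set f₀ : MvPolynomial (Fin d ⊕ ℕ) S →+* R ⧸ I := F₀.1.comp (algebraMap _ _) with hf₀
  have hgf : ∀ b, f₀ (divisionMap c u b) = Ideal.Quotient.mk I (g b) := by
    intro b
    have := completionMap_algebraMap (divisionMap c u).toRingHom x F₀ b
    rw [hGF] at this
    exact this.symm
  have hgC : ∀ s, f₀ (MvPolynomial.C s) = Ideal.Quotient.mk I (g (MvPolynomial.C s)) := fun s => by
    rw [← hgf, divisionMap_C]
  have hJ := isNilpotent_comap_mk hI F₀.isNilpotent_map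
  set J := (Ideal.map F₀.1 (IsLocalRing.maximalIdeal
    (Localization.AtPrime x.asIdeal))).comap (Ideal.Quotient.mk I)
  obtain ⟨r, hrd, hlow, hr⟩ := exists_first_coeff_notMem x.asIdeal
    (fun i => (MvPolynomial.C (c i) : MvPolynomial (Fin d ⊕ ℕ) S))
  have hcoeff : ∀ i, f₀ ((monicPoly fun i => (MvPolynomial.C (c i) :
      MvPolynomial (Fin d ⊕ ℕ) S)).coeff i) =
      Ideal.Quotient.mk I ((monicPoly fun i => g (MvPolynomial.C (c i))).coeff i) := by
    intro i
    simp only [← Polynomial.coeff_map, map_monicPoly, hgC]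
  obtain ⟨a, v, hav, ha, hv⟩ := exists_lift_dBetaSeries hJ hrd
    (c := fun i => g (MvPolynomial.C (c i))) (u := fun j => g (MvPolynomial.C (u j)))
    ((hu.map (MvPolynomial.C (σ := ℕ))).map g)
    (fun i hi => by
      rw [Ideal.mem_comap, ← hcoeff]
      exact F₀.algebraMap_mem_map (hlow i hi))
    (by
      rw [← hI.isUnit_quotient_mk_iff, ← hcoeff]
      exact F₀.isUnit_algebraMap hr)
    I (PowerSeries.mk fun n => g (MvPolynomial.X n))
    (fun i => f₀ (MvPolynomial.X (Sum.inl i))) (fun j => f₀ (MvPolynomial.X (Sum.inr j)))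
    (by
      ext n
      have := map_divisionMap_X c u f₀ n
      rw [hgf] at this
      simp only [hgC] at this
      rw [← this]
      simp)
  set f := MvPolynomial.eval₂Hom (g.comp MvPolynomial.C) (Sum.elim a v)
  have hfφ : ∀ b, f (divisionMap c u b) = g b := eval₂Hom_comp_divisionMap c u g hav
  have hff₀ : (Ideal.Quotient.mk I).comp f = f₀ := by
    refine MvPolynomial.ringHom_ext (fun s => ?_) ?_
    · simp [f, hgC]
    · rintro (i | j)
      · simp [f, ha]
      · simp [f, hv]
  have hff : ∀ z, Ideal.Quotient.mk I (f z) = f₀ z := fun z => DFunLike.congr_fun hff₀ z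
  -- Both conditions at `x` can be tested modulo `I`, where `f` becomes `f₀`: `J` is a preimage, and
  -- units lift along a nilpotent ideal.
  obtain ⟨F, hF⟩ := exists_formalPt x f hJ
    (fun z hz => by
      rw [Ideal.mem_comap, hff]
      exact F₀.algebraMap_mem_map hz)
    (fun z hz => by
      rw [← hI.isUnit_quotient_mk_iff, hff]
      exact F₀.isUnit_algebraMap hz)
  refine ⟨F, ?_, ?_⟩
  · refine FormalPt.ext_algebraMap (x := x.comap (divisionMap c u).toRingHom)
      (RingHom.ext fun b => ?_)
    refine (completionMap_algebraMap _ x F b).trans ?_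
    rw [hF]
    exact hfφ b
  · refine FormalPt.ext_algebraMap (RingHom.ext fun z => ?_)
    change Ideal.Quotient.mk I (F.1 (algebraMap _ _ z)) = f₀ z
    rw [hF, hff]

/-- Modulo the lower coefficients of `q`, the comorphism `divisionMap c u` is surjective. -/
lemma exists_sub_divisionMap_mem (hu : IsUnit (u 0)) (z : MvPolynomial (Fin d ⊕ ℕ) S) :
    ∃ b, z - divisionMap c u b ∈ Ideal.span (Set.range fun i =>
      (MvPolynomial.C (c i) : MvPolynomial (Fin d ⊕ ℕ) S)) := by
  set J := Ideal.span (Set.range fun i => (MvPolynomial.C (c i) : MvPolynomial (Fin d ⊕ ℕ) S))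
    with hJ
  set π : MvPolynomial (Fin d ⊕ ℕ) S →+* MvPolynomial (Fin d ⊕ ℕ) S ⧸ J := Ideal.Quotient.mk J
  set ψ := π.comp (divisionMap c u).toRingHom
  have hπc : ∀ i, π (MvPolynomial.C (c i)) = 0 := fun i =>
    Ideal.Quotient.eq_zero_iff_mem.mpr (Ideal.subset_span ⟨i, rfl⟩)
  have hC : ∀ s, π (MvPolynomial.C s) ∈ ψ.range := fun s =>
    ⟨MvPolynomial.C s, congrArg π (divisionMap_C c u s)⟩
  have hmul : ∀ f g : PowerSeries (MvPolynomial (Fin d ⊕ ℕ) S ⧸ J),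
      (∀ n, PowerSeries.coeff n f ∈ ψ.range) → (∀ n, PowerSeries.coeff n g ∈ ψ.range) →
      ∀ n, PowerSeries.coeff n (f * g) ∈ ψ.range := by
    intro f g hf hg n
    rw [PowerSeries.coeff_mul]
    exact sum_mem fun p _ => mul_mem (hf _) (hg _)
  obtain ⟨u', hu'⟩ := (isUnit_mk hu).exists_right_inv
  set τ := PowerSeries.map (π.comp MvPolynomial.C)
  have hτ : ∀ (f : PowerSeries S) n, PowerSeries.coeff n (τ f) ∈ ψ.range := fun f n => by
    rw [PowerSeries.coeff_map]
    exact hC _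
  set a : Fin d → MvPolynomial (Fin d ⊕ ℕ) S ⧸ J := fun i => π (MvPolynomial.X (Sum.inl i)) with ha
  set v : ℕ → MvPolynomial (Fin d ⊕ ℕ) S ⧸ J := fun j => π (MvPolynomial.X (Sum.inr j)) with hv
  have hq : (monicPoly fun i => π (MvPolynomial.C (c i))) = Polynomial.X ^ d := by
    simp [monicPoly, lowPoly, hπc]
  have hw : ∀ n, PowerSeries.coeff n (τ (PowerSeries.mk u) * (lowPoly a : PowerSeries _) +
      PowerSeries.X ^ d * PowerSeries.mk v) ∈ ψ.range := by
    intro n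
    refine ⟨MvPolynomial.X n, (map_divisionMap_X c u π n).trans ?_⟩
    rw [dBetaSeries, hq, Polynomial.coe_pow, Polynomial.coe_X]
    congr 3
  have hone : τ (PowerSeries.mk u) * τ u' = 1 := by rw [← map_mul, hu', map_one]
  -- Modulo `J` the polynomial `q` is `t ^ d`, so multiplication by `u⁻¹` separates the unknowns:
  -- degrees below `d` show `a`, the others show `u⁻¹ v`.
  have hw' : ∀ n, PowerSeries.coeff n ((lowPoly a : PowerSeries _) +
      PowerSeries.X ^ d * (τ u' * PowerSeries.mk v)) ∈ ψ.range := by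
    intro n
    have := hmul _ _ (hτ u') hw n
    convert this using 2
    linear_combination -(lowPoly a : PowerSeries (MvPolynomial (Fin d ⊕ ℕ) S ⧸ J)) * hone
  have haP : ∀ i, a i ∈ ψ.range := by
    intro i
    have := hw' i
    rwa [map_add, Polynomial.coeff_coe, coeff_lowPoly, dif_pos i.2, PowerSeries.coeff_X_pow_mul',
      if_neg (not_le.mpr i.2), add_zero] at this
  have hvP : ∀ j, v j ∈ ψ.range := by
    have h1 : ∀ j, PowerSeries.coeff j (τ u' * PowerSeries.mk v) ∈ ψ.range := by
      intro j
      have := hw' (j + d)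
      rwa [map_add, Polynomial.coeff_coe, coeff_lowPoly, dif_neg (by lia),
        PowerSeries.coeff_X_pow_mul, zero_add] at this
    intro j
    have := hmul _ _ (hτ (PowerSeries.mk u)) h1 j
    rwa [← mul_assoc, hone, one_mul, PowerSeries.coeff_mk] at this
  have hz : π z ∈ ψ.range := by
    induction z using MvPolynomial.induction_on with
    | C s => exact hC s
    | add p q hp hq => rw [map_add]; exact add_mem hp hq
    | mul_X p i hp =>
      rw [map_mul]
      refine mul_mem hp ?_
      rcases i with i | j
      · exact haP i
      · exact hvP j
  obtain ⟨b, hb⟩ := hz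
  exact ⟨b, Ideal.Quotient.eq.mp hb.symm⟩

/-- Over the origin the lower coefficients of `q` lie in `x`, so they become nilpotent at every
formal point: solutions of `u a + q v = w` exist and are unique. -/
theorem isIsoOnCompletion_divisionMap (hu : IsUnit (u 0))
    (x : PrimeSpectrum (MvPolynomial (Fin d ⊕ ℕ) S))
    (hx : IsOverOrigin (fun i => MvPolynomial.C (c i)) x) :
    IsIsoOnCompletion (divisionMap c u).toRingHom x := by
  have hcx : ∀ i, MvPolynomial.C (c i) ∈ x.asIdeal := by
    intro i
    have := congrArg (fun p => Polynomial.coeff p (i : ℕ)) hx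
    simp only [Polynomial.coeff_map, coeff_monicPoly_of_lt _ i.2, Polynomial.coeff_X_pow,
      i.2.ne, if_false] at this
    exact Ideal.algebraMap_residueField_eq_zero.mp this
  intro R _
  constructor
  · intro F F' hFF
    set f : MvPolynomial (Fin d ⊕ ℕ) S →+* R := F.1.comp (algebraMap _ _) with hf
    set f' : MvPolynomial (Fin d ⊕ ℕ) S →+* R := F'.1.comp (algebraMap _ _) with hf'
    have hφ : ∀ b, f (divisionMap c u b) = f' (divisionMap c u b) := by
      intro b
      have h := completionMap_algebraMap (divisionMap c u).toRingHom x F b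
      rw [hFF] at h
      exact h.symm.trans (completionMap_algebraMap (divisionMap c u).toRingHom x F' b)
    have hC : ∀ s, f (MvPolynomial.C s) = f' (MvPolynomial.C s) := fun s => by
      rw [← divisionMap_C c u, hφ]
    have hs : dBetaSeries (fun i => f (MvPolynomial.C (c i))) (fun j => f (MvPolynomial.C (u j)))
        (fun i => f (MvPolynomial.X (Sum.inl i))) (fun j => f (MvPolynomial.X (Sum.inr j))) =
        dBetaSeries (fun i => f (MvPolynomial.C (c i))) (fun j => f (MvPolynomial.C (u j)))
        (fun i => f' (MvPolynomial.X (Sum.inl i))) (fun j => f' (MvPolynomial.X (Sum.inr j))) := by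
      ext n
      rw [← map_divisionMap_X, hφ, map_divisionMap_X]
      simp only [hC]
    obtain ⟨ha, hv⟩ := dBetaSeries_injective F.isNilpotent_map
      ((hu.map (MvPolynomial.C (σ := Fin d ⊕ ℕ))).map f)
      (fun i => F.algebraMap_mem_map (hcx i)) hs
    refine FormalPt.ext_algebraMap (MvPolynomial.ringHom_ext hC ?_)
    rintro (i | j)
    · exact congrFun ha i
    · exact congrFun hv j
  · intro G
    let y : PrimeSpectrum (MvPolynomial ℕ S) := x.comap (divisionMap c u).toRingHom
    change FormalPt (Localization.AtPrime y.asIdeal) R at G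
    have hy : ∀ b, b ∈ y.asIdeal ↔ divisionMap c u b ∈ x.asIdeal := fun b => Iff.rfl
    set g : MvPolynomial ℕ S →+* R := G.1.comp (algebraMap _ _) with hg
    have hJ := G.isNilpotent_map
    set J := Ideal.map G.1 (IsLocalRing.maximalIdeal (Localization.AtPrime y.asIdeal))
    have hgc : ∀ i, g (MvPolynomial.C (c i)) ∈ J := fun i =>
      G.algebraMap_mem_map ((hy _).mpr (by rw [divisionMap_C]; exact hcx i))
    obtain ⟨a, v, hav, -⟩ := exists_dBetaSeries_eq hJ le_rfl
      (c := fun i => g (MvPolynomial.C (c i))) (u := fun j => g (MvPolynomial.C (u j)))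
      ((hu.map (MvPolynomial.C (σ := ℕ))).map g)
      (fun i hi => by rw [coeff_monicPoly_of_lt _ hi]; exact hgc _)
      (by rw [coeff_monicPoly_self]; exact isUnit_one) ⊤
      (PowerSeries.mk fun n => g (MvPolynomial.X n)) (by simp)
    set f := MvPolynomial.eval₂Hom (g.comp MvPolynomial.C) (Sum.elim a v) with hfdef
    have hfφ : ∀ b, f (divisionMap c u b) = g b := eval₂Hom_comp_divisionMap c u g hav
    -- The solution yields a homomorphism `f`, but only `g` is known to be a formal point. Modulo
    -- the coefficients of `q` every `z` comes from some `b`, so the conditions on `f` at `x` follow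
    -- from those on `g` at `y`.
    have happrox : ∀ z, ∃ b, (z ∈ x.asIdeal ↔ b ∈ y.asIdeal) ∧ f z - g b ∈ J := by
      intro z
      obtain ⟨b, hb⟩ := exists_sub_divisionMap_mem c hu z
      refine ⟨b, ?_, ?_⟩
      · rw [hy]
        have hb' : z - divisionMap c u b ∈ x.asIdeal := by
          refine Ideal.span_le.mpr ?_ hb
          rintro _ ⟨i, rfl⟩
          exact hcx i
        exact ⟨fun h => by simpa using sub_mem h hb', fun h => by simpa using add_mem hb' h⟩
      · rw [← hfφ, ← map_sub, ← Ideal.mem_comap]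
        refine Ideal.span_le.mpr ?_ hb
        rintro _ ⟨i, rfl⟩
        change f (MvPolynomial.C (c i)) ∈ J
        rw [← divisionMap_C c u, hfφ]
        exact hgc i
    obtain ⟨F, hF⟩ := exists_formalPt x f hJ
      (fun z hz => by
        obtain ⟨b, hzb, hb⟩ := happrox z
        have hgb : g b ∈ J := G.algebraMap_mem_map (hzb.mp hz)
        simpa using add_mem hb hgb)
      (fun z hz => by
        obtain ⟨b, hzb, hb⟩ := happrox z
        rw [← hJ.isUnit_quotient_mk_iff, Ideal.Quotient.eq.mpr hb, hJ.isUnit_quotient_mk_iff]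
        exact G.isUnit_algebraMap (mt hzb.mpr hz))
    refine ⟨F, FormalPt.ext_algebraMap (x := y) (RingHom.ext fun b => ?_)⟩
    refine (completionMap_algebraMap _ x F b).trans ?_
    rw [hF]
    exact hfφ b

end DivisionMap

/-! ### Specialization to `α_d` and `dβ_d`, and the morphism on jets. -/

section Jets

variable (k : Type u) [Field k] (d : ℕ)

lemma dBeta_eq_divisionMap : dBeta k d = divisionMap (coordq k d) (coordu k d) := rfl

lemma alpha_eq_divisionMap :
    alpha k d = divisionMap (fun i => (MvPolynomial.X i : CoordQ k d)) (Pi.single 0 1) := by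
  rw [divisionMap_single]
  rfl

lemma isUnit_coordu_zero : IsUnit (coordu k d 0) :=
  IsLocalization.Away.algebraMap_isUnit _

lemma isBundleLinear_alphaN (n : ℕ) : IsBundleLinear (alphaN k d n) := by
  intro R _ s
  constructor
  · intro w w'
    funext i
    rw [Pi.add_apply, fiberMap_alphaN, fiberMap_alphaN, fiberMap_alphaN, ← Polynomial.coeff_add]
    congr 1
    have h1 := lowPoly_add (fun i => w (Sum.inl i)) (fun i => w' (Sum.inl i))
    have h2 := lowPoly_add (fun i => w (Sum.inr i)) (fun i => w' (Sum.inr i))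
    simp only [Pi.add_def] at h1 h2
    simp only [alphaJet, Pi.add_apply, h1, h2]
    ring
  · intro r w
    funext i
    rw [Pi.smul_apply, fiberMap_alphaN, fiberMap_alphaN, smul_eq_mul, ← Polynomial.coeff_C_mul]
    congr 1
    have h1 := lowPoly_smul r (fun i => w (Sum.inl i))
    have h2 := lowPoly_smul r (fun i => w (Sum.inr i))
    simp only [Pi.smul_def] at h1 h2
    simp only [alphaJet, Pi.smul_apply, h1, h2]
    ring

/-- Regard the jet as a power series, divide it by `q` over `K`, and truncate the quotient. -/
lemma fiberMap_alphaN_surjective (n : ℕ) {K : Type v} [Field K] (q : CoordQ k d →+* K) :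
    Function.Surjective (fiberMap (alphaN k d n) q) := by
  intro w
  obtain ⟨a, v, h⟩ := exists_dBetaSeries_eq_of_field (fun i => q (MvPolynomial.X i))
    (Pi.single 0 1) (by simp) (lowPoly w : PowerSeries K)
  rw [← alphaSeries_eq_dBetaSeries] at h
  refine ⟨Sum.elim a fun j => v j, ?_⟩
  funext i
  have h' := congrArg (PowerSeries.coeff (i : ℕ)) h
  rw [Polynomial.coeff_coe, coeff_lowPoly, dif_pos i.2] at h'
  rw [fiberMap_alphaN, ← h', alphaSeries, alphaJet, map_add, Polynomial.coeff_add,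
    Polynomial.coeff_coe, PowerSeries.coeff_mul, Polynomial.coeff_mul]
  congr 1
  -- The coefficient of `t ^ i` in `q v` with `i ≤ n` involves only `v₀, …, v_n`, so truncating `v`
  -- does not affect it.
  refine Finset.sum_congr rfl fun p hp => ?_
  have hp2 : p.2 < n + 1 := by
    have := Finset.HasAntidiagonal.mem_antidiagonal.mp hp
    have := i.2
    lia
  rw [coeff_lowPoly, dif_pos hp2, Polynomial.coeff_coe, PowerSeries.coeff_mk, Sum.elim_inr]

end Jets

end WeierstrassDivision

end

open WeierstrassDivision in
theorem mainTheorem8 (k : Type u) [Field k] (d : ℕ) :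
    -- `α_d` and `dβ_d` are surjective on points
    (Function.Surjective (PrimeSpectrum.comap (alpha k d).toRingHom) ∧
      Function.Surjective (PrimeSpectrum.comap (dBeta k d).toRingHom)) ∧
    -- and on `K`-points, for every extension field `K` of `k`
    (∀ (K : Type v) [Field K] [Algebra k K],
      (∀ y : CoordQL k d →ₐ[k] K, ∃ x : CoordQAL k d →ₐ[k] K,
        x.comp ((alpha k d).restrictScalars k) = y) ∧
      (∀ y : CoordTYX k d →ₐ[k] K, ∃ x : CoordTX k d →ₐ[k] K,
        x.comp ((dBeta k d).restrictScalars k) = y)) ∧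
    -- they induce formally smooth morphisms on formal completions at points
    ((∀ x : PrimeSpectrum (CoordQAL k d),
        FormallySmoothOnCompletion (alpha k d).toRingHom x) ∧
      (∀ x : PrimeSpectrum (CoordTX k d),
        FormallySmoothOnCompletion (dBeta k d).toRingHom x)) ∧
    -- and isomorphisms on formal completions at points over `q = t^d`
    ((∀ x : PrimeSpectrum (CoordQAL k d),
        IsOverOrigin (fun i => MvPolynomial.C (MvPolynomial.X i)) x →
          IsIsoOnCompletion (alpha k d).toRingHom x) ∧
      (∀ x : PrimeSpectrum (CoordTX k d),
        IsOverOrigin (fun i => MvPolynomial.C (coordq k d i)) x →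
          IsIsoOnCompletion (dBeta k d).toRingHom x)) ∧
    -- `α_{d,n}` is a linear map of vector bundles over `Q_d`, surjective on every fibre
    (∀ n : ℕ, d ≤ n →
      IsBundleLinear (alphaN k d n) ∧
      ∀ (K : Type v) [Field K] [Algebra k K] (q : CoordQ k d →ₐ[k] K),
        Function.Surjective (fiberMap (alphaN k d n) (q : CoordQ k d →+* K))) := by
  have hone : IsUnit ((Pi.single 0 1 : ℕ → CoordQ k d) 0) := by simp
  have hu := isUnit_coordu_zero k d
  rw [alpha_eq_divisionMap, dBeta_eq_divisionMap]
  exact ⟨⟨comap_divisionMap_surjective _ hone, comap_divisionMap_surjective _ hu⟩,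
    fun K _ _ => ⟨exists_algHom_extension _ hone k, exists_algHom_extension _ hu k⟩,
    ⟨formallySmoothOnCompletion_divisionMap _ hone, formallySmoothOnCompletion_divisionMap _ hu⟩,
    ⟨isIsoOnCompletion_divisionMap _ hone, isIsoOnCompletion_divisionMap _ hu⟩,
    fun n _ => ⟨isBundleLinear_alphaN k d n, fun K _ _ q =>
      fiberMap_alphaN_surjective k d n (q : CoordQ k d →+* K)⟩⟩
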